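/- Let $c>0$ and $n>c$ be real numbers. For $k\in\mathbb{N}_0$ and $x\ge 0$ put $$p_{n,k}^{[c]}(x):=\binom{-n/c}{k}(-cx)^k(1+cx)^{-n/c-k},\qquad \binom{a}{k}:=\frac{a(a-1)\cdots(a-k+1)}{k!},$$ and let $S_{n,c}(x):=\sum_{k=0}^{\infty}\bigl(p_{n,k}^{[c]}(x)\bigr)^2$ (this series converges for every $x\ge 0$). For $t\ge 0$ write $$T:=t+ct^2,\qquad \rho:=\sqrt{n^2+c^2},\qquad R:=\sqrt{16\rho^2T^2+8cT+1}.$$ Then for every $t\ge 0$ $$S_{n,c}(t)^2\le \frac{2}{1+4cT+R}\left(\frac{1}{R+4nT}\right)^{n/c}\left(\frac{\rho R+4\rho^2T+c}{\rho+c}\right)^{\rho/c}\le \frac{1}{1+4cT}\bigl(1+4(n+c)T\bigr)^{-n/c}\bigl(1+8\rho T\bigr)^{\rho/c}.$$ Consequently, $$S_{n,c}(t)=\mathcal{O}\left(t^{(\rho-n-c)/c}\right),\qquad t\to\infty .$$ -/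

import Mathlib

open Filter Asymptotics

/-- The generalized binomial coefficient `Ring.choose a k` over the reals is
`a (a - 1) ⋯ (a - k + 1) / k!`. -/
theorem ringChoose_eq_prod_div (a : ℝ) (k : ℕ) :
    Ring.choose a k = (∏ i ∈ Finset.range k, (a - i)) / (k.factorial : ℝ) := by
  have h := Ring.descPochhammer_eq_factorial_smul_choose a k
  rw [← Polynomial.aeval_eq_smeval, Polynomial.aeval_def, ← Polynomial.eval_map,
    descPochhammer_map, descPochhammer_eval_eq_prod_range, nsmul_eq_mul] at h
  rw [h, mul_div_cancel_left₀]
  exact_mod_cast k.factorial_ne_zero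

/-- The probabilities `p_{n,k}^{[c]}(x)`: for `c ≠ 0` it is
`(-n/c choose k) (-c x)^k (1 + c x)^(-n/c - k)`, and for `c = 0` the Poisson weight. -/
noncomputable def indexProb (n c : ℝ) (k : ℕ) (x : ℝ) : ℝ :=
  if c = 0 then (n * x) ^ k / (k.factorial : ℝ) * Real.exp (-(n * x))
  else Ring.choose (-n / c) k * (-c * x) ^ k * (1 + c * x) ^ (-n / c - (k : ℝ))

/-- The index of coincidence `S_{n,c}(x) = ∑ₖ p_{n,k}^{[c]}(x)²`. -/
noncomputable def indexCoincidence (n c x : ℝ) : ℝ :=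
  ∑' k : ℕ, indexProb n c k x ^ 2

/-! With `a = n/c` and `s = ct`, the series is `Y(s) = (1+s)^(-2a) F((s/(1+s))²)`, where `F = ₂F₁(a,
a; 1; ·)`. The hypergeometric equation for `F` turns into a Riccati equation `g' = -(g - h)(g - h₋)`
for `g = Y'/Y`, with `h₋ < h` the roots of an explicit quadratic (`hasDerivAt_coincLogDeriv`).

The root `h` increases with `s` (`riccatiRoot_mono`), and `g(0) = h(0) = -2a`. If `g(s) > h(s)`,
then going left from `s` the function `g` can only grow, since it decreases in `s` wherever it
exceeds `h`. Hence `g(0) ≥ g(s) > h(s) ≥ h(0)`, a contradiction. So `g ≤ h` (`coincLogDeriv_le`).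

In the variable `u = 4s(1+s) = 4cT`, the function `2h` has an elementary antiderivative
(`hasDerivAt_logBound`); integrating from `0` and exponentiating gives the first bound. Linear
estimates of `R` give the second, and `u ≍ t²` gives the growth rate. -/

/-! ### Power series with coefficients of polynomial growth -/

/-- The coefficients of the formal derivative of `∑ e k z ^ k`. -/
def derivCoeff (e : ℕ → ℝ) (k : ℕ) : ℝ := (k + 1) * e (k + 1)

/-- The sum of the power series with coefficients `e`. -/
noncomputable def powSum (e : ℕ → ℝ) (z : ℝ) : ℝ := ∑' k : ℕ, e k * z ^ k

/-- Sequences of at most polynomial growth. -/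
def PolyGrowth (e : ℕ → ℝ) : Prop :=
  ∃ (C : ℝ) (m : ℕ), ∀ k : ℕ, |e k| ≤ C * ((k : ℝ) + 1) ^ m

theorem PolyGrowth.derivCoeff {e : ℕ → ℝ} (he : PolyGrowth e) : PolyGrowth (derivCoeff e) := by
  obtain ⟨C, m, h⟩ := he
  have hC : 0 ≤ C := by simpa using (abs_nonneg _).trans (h 0)
  refine ⟨C * 2 ^ m, m + 1, fun k => ?_⟩
  have h1 := h (k + 1)
  push_cast at h1
  have h2 : ((k : ℝ) + 1 + 1) ^ m ≤ (2 * ((k : ℝ) + 1)) ^ m := by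
    gcongr
    have : (0 : ℝ) ≤ k := k.cast_nonneg
    linarith
  rw [_root_.derivCoeff, abs_mul, abs_of_nonneg (by positivity : (0 : ℝ) ≤ (k : ℝ) + 1)]
  calc ((k : ℝ) + 1) * |e (k + 1)| ≤ (k + 1) * (C * (2 * ((k : ℝ) + 1)) ^ m) := by
        gcongr
        exact h1.trans (by gcongr)
    _ = C * 2 ^ m * ((k : ℝ) + 1) ^ (m + 1) := by rw [mul_pow]; ring

theorem summable_succ_pow_mul_geometric (m : ℕ) {r : ℝ} (h0 : 0 < r) (h1 : r < 1) :
    Summable fun k : ℕ => ((k : ℝ) + 1) ^ m * r ^ k := by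
  have h := (summable_nat_add_iff 1).2
    (summable_pow_mul_geometric_of_norm_lt_one m (r := r) (by rwa [Real.norm_of_nonneg h0.le]))
  refine (h.mul_left r⁻¹).congr fun k => ?_
  push_cast
  field_simp
  ring

theorem PolyGrowth.summable {e : ℕ → ℝ} (he : PolyGrowth e) {z : ℝ} (hz : |z| < 1) :
    Summable fun k : ℕ => e k * z ^ k := by
  obtain ⟨C, m, h⟩ := he
  have hC : 0 ≤ C := by simpa using (abs_nonneg _).trans (h 0)
  obtain ⟨r, hr, hr1⟩ := exists_between hz
  have h0 : 0 < r := (abs_nonneg z).trans_lt hr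
  refine Summable.of_norm_bounded ((summable_succ_pow_mul_geometric m h0 hr1).mul_left C)
    fun k => ?_
  rw [norm_mul, norm_pow, Real.norm_eq_abs, Real.norm_eq_abs, ← mul_assoc]
  gcongr
  exact h k

theorem PolyGrowth.hasSum {e : ℕ → ℝ} (he : PolyGrowth e) {z : ℝ} (hz : |z| < 1) :
    HasSum (fun k : ℕ => e k * z ^ k) (powSum e z) := (he.summable hz).hasSum

theorem hasSum_of_hasSum_succ {f : ℕ → ℝ} {s : ℝ} (h0 : f 0 = 0)
    (h : HasSum (fun k => f (k + 1)) s) : HasSum f s := by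
  rw [← hasSum_nat_add_iff' 1]
  simpa [h0] using h

theorem HasSum.congr_pointwise {f g : ℕ → ℝ} {s : ℝ} (h : HasSum f s) (hfg : ∀ k, g k = f k) :
    HasSum g s := by rwa [funext hfg]

theorem hasSum_mul_of_derivCoeff {e : ℕ → ℝ} {z s : ℝ}
    (h : HasSum (fun k : ℕ => derivCoeff e k * z ^ k) s) :
    HasSum (fun k : ℕ => k * e k * z ^ k) (z * s) := by
  refine hasSum_of_hasSum_succ (by simp) ((h.mul_left z).congr_pointwise fun k => ?_)
  simp only [derivCoeff]
  push_cast
  ring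

theorem PolyGrowth.hasDerivAt {e : ℕ → ℝ} (he : PolyGrowth e) {z : ℝ} (hz : |z| < 1) :
    HasDerivAt (powSum e) (powSum (_root_.derivCoeff e) z) z := by
  obtain ⟨C, m, h⟩ := he.derivCoeff
  have hC : 0 ≤ C := by simpa using (abs_nonneg _).trans (h 0)
  obtain ⟨r, hr, hr1⟩ := exists_between hz
  have h0 : 0 < r := (abs_nonneg z).trans_lt hr
  have hu : Summable fun k : ℕ => C * ((k : ℝ) ^ m * r ^ (k - 1)) := by
    refine Summable.mul_left C ((summable_nat_add_iff 1).1 ?_)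
    simpa using summable_succ_pow_mul_geometric m h0 hr1
  have key := hasDerivAt_tsum_of_isPreconnected (u := fun k : ℕ => C * ((k : ℝ) ^ m * r ^ (k - 1)))
    (g := fun (k : ℕ) (y : ℝ) => e k * y ^ k) (g' := fun (k : ℕ) (y : ℝ) => e k * (k * y ^ (k - 1)))
    (t := Metric.ball 0 r) (y₀ := 0) (y := z) hu Metric.isOpen_ball
    (convex_ball (0 : ℝ) r).isPreconnected
    (fun k y _ => (hasDerivAt_pow k y).const_mul (e k))
    (fun k y hy => by
      rw [mem_ball_zero_iff, Real.norm_eq_abs] at hy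
      rcases k with _ | k
      · simp
        positivity
      · have hk := h k
        simp only [_root_.derivCoeff] at hk
        rw [← mul_assoc, norm_mul, norm_pow, Real.norm_eq_abs, Real.norm_eq_abs, ← mul_assoc]
        push_cast
        rw [mul_comm (e (k + 1))]
        gcongr)
    (Metric.mem_ball_self h0) (he.summable (by simp)) (by simpa using hr)
  have hs : HasSum (fun k : ℕ => e k * (k * z ^ (k - 1))) (powSum (_root_.derivCoeff e) z) := by
    refine hasSum_of_hasSum_succ (by simp) ((he.derivCoeff.hasSum hz).congr_pointwise fun k => ?_)
    simp only [_root_.derivCoeff, Nat.add_sub_cancel]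
    push_cast
    ring
  rw [← hs.tsum_eq]
  exact key

theorem powSum_pos {e : ℕ → ℝ} (he : PolyGrowth e) (h0 : 0 < e 0) (hnn : ∀ k, 0 ≤ e k) {z : ℝ}
    (hz0 : 0 ≤ z) (hz : z < 1) : 0 < powSum e z :=
  (he.summable (by rwa [abs_of_nonneg hz0])).tsum_pos (fun k => mul_nonneg (hnn k) (pow_nonneg hz0 k))
    0 (by simpa using h0)

theorem powSum_zero (e : ℕ → ℝ) : powSum e 0 = e 0 := by
  rw [powSum, tsum_eq_single 0 (fun k hk => by simp [hk])]
  simp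

/-! ### The hypergeometric function and its differential equation -/

/-- The coefficients `((a)_k / k!) ^ 2` of the hypergeometric function `₂F₁(a, a; 1; z)`. -/
noncomputable def sqCoeff (a : ℝ) (k : ℕ) : ℝ := Ring.choose (-a) k ^ 2

theorem succ_mul_ringChoose (a : ℝ) (k : ℕ) :
    ((k : ℝ) + 1) * Ring.choose (-a) (k + 1) = -(a + k) * Ring.choose (-a) k := by
  rw [ringChoose_eq_prod_div, ringChoose_eq_prod_div, Finset.prod_range_succ, Nat.factorial_succ]
  have : (k.factorial : ℝ) ≠ 0 := by exact_mod_cast k.factorial_ne_zero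
  push_cast
  field_simp
  ring

theorem sqCoeff_succ (a : ℝ) (k : ℕ) :
    ((k : ℝ) + 1) ^ 2 * sqCoeff a (k + 1) = (a + k) ^ 2 * sqCoeff a k := by
  rw [sqCoeff, sqCoeff, ← mul_pow, succ_mul_ringChoose]
  ring

theorem sqCoeff_zero (a : ℝ) : sqCoeff a 0 = 1 := by
  simp [sqCoeff]

theorem sqCoeff_nonneg (a : ℝ) (k : ℕ) : 0 ≤ sqCoeff a k := sq_nonneg _

/-- For an integer `N ≥ a`, Bernoulli's inequality bounds the ratio `(a+k)/(k+1)` of consecutive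
binomials by `((k+2)/(k+1))^N`, and the product telescopes. -/
theorem polyGrowth_sqCoeff {a : ℝ} (ha : 0 < a) : PolyGrowth (sqCoeff a) := by
  obtain ⟨N, hN⟩ := exists_nat_ge a
  have h : ∀ k : ℕ, |Ring.choose (-a) k| ≤ ((k : ℝ) + 1) ^ N := by
    intro k
    induction k with
    | zero => simp
    | succ k ih =>
      have hk : (0 : ℝ) < (k : ℝ) + 1 := by positivity
      have h1 : ((k : ℝ) + 1) * |Ring.choose (-a) (k + 1)| = (a + k) * |Ring.choose (-a) k| := by
        have := congrArg abs (succ_mul_ringChoose a k)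
        rwa [abs_mul, abs_mul, abs_neg, abs_of_pos hk,
          abs_of_nonneg (by positivity : 0 ≤ a + k)] at this
      have h2 : 1 + (N : ℝ) * (1 / ((k : ℝ) + 1)) ≤ (1 + 1 / ((k : ℝ) + 1)) ^ N :=
        one_add_mul_le_pow (le_trans (by norm_num) (by positivity : (0 : ℝ) ≤ 1 / ((k : ℝ) + 1))) N
      have hc : (a + k) ≤ (k + 1) * (1 + 1 / ((k : ℝ) + 1)) ^ N :=
        calc a + k ≤ (k + 1) * (1 + (N : ℝ) * (1 / ((k : ℝ) + 1))) := by
              field_simp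
              linarith
          _ ≤ _ := by gcongr
      have h4 : (1 + 1 / ((k : ℝ) + 1)) * ((k : ℝ) + 1) = k + 1 + 1 := by
        field_simp
      push_cast
      refine le_of_mul_le_mul_left ?_ hk
      calc ((k : ℝ) + 1) * |Ring.choose (-a) (k + 1)| = (a + k) * |Ring.choose (-a) k| := h1
        _ ≤ ((k + 1) * (1 + 1 / ((k : ℝ) + 1)) ^ N) * ((k : ℝ) + 1) ^ N := by gcongr
        _ = (k + 1) * ((1 + 1 / ((k : ℝ) + 1)) * ((k : ℝ) + 1)) ^ N := by rw [mul_pow]; ring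
        _ = _ := by rw [h4]
  refine ⟨1, 2 * N, fun k => ?_⟩
  rw [sqCoeff, abs_pow, one_mul, mul_comm 2 N, pow_mul]
  have := h k
  gcongr

/-- The hypergeometric differential equation of `₂F₁(a, a; 1; z)`. -/
theorem powSum_sqCoeff_ode {a : ℝ} (ha : 0 < a) {z : ℝ} (hz : |z| < 1) :
    z * (1 - z) * powSum (derivCoeff (derivCoeff (sqCoeff a))) z
      + (1 - (2 * a + 1) * z) * powSum (derivCoeff (sqCoeff a)) z
      - a ^ 2 * powSum (sqCoeff a) z = 0 := by
  have g0 := polyGrowth_sqCoeff ha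
  have s0 := g0.hasSum hz
  have s1 := g0.derivCoeff.hasSum hz
  have s2 := g0.derivCoeff.derivCoeff.hasSum hz
  have zs1 := hasSum_mul_of_derivCoeff s1
  have zs2 := hasSum_mul_of_derivCoeff s2
  have zzs2 : HasSum (fun k : ℕ => (k : ℝ) * (k - 1) * sqCoeff a k * z ^ k)
      (z * (z * powSum (derivCoeff (derivCoeff (sqCoeff a))) z)) := by
    refine hasSum_of_hasSum_succ (by simp) ((zs2.mul_left z).congr_pointwise fun k => ?_)
    simp only [derivCoeff]
    push_cast
    ring
  have key := (((zs2.sub zzs2).add s1).sub (zs1.mul_left (2 * a + 1))).sub (s0.mul_left (a ^ 2))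
  have hz : (fun k : ℕ => (k : ℝ) * derivCoeff (sqCoeff a) k * z ^ k -
      (k : ℝ) * (k - 1) * sqCoeff a k * z ^ k + derivCoeff (sqCoeff a) k * z ^ k -
      (2 * a + 1) * (k * sqCoeff a k * z ^ k) - a ^ 2 * (sqCoeff a k * z ^ k)) = fun _ => 0 := by
    funext k
    simp only [derivCoeff]
    -- Coefficient by coefficient, the equation is the recurrence for `sqCoeff`.
    linear_combination z ^ k * sqCoeff_succ a k
  rw [hz] at key
  linear_combination key.unique hasSum_zero

/-! ### The logarithmic derivative and its Riccati equation -/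

theorem sq_div_one_add_mem {s : ℝ} (hs : 0 ≤ s) :
    0 ≤ (s / (1 + s)) ^ 2 ∧ (s / (1 + s)) ^ 2 < 1 := by
  refine ⟨sq_nonneg _, ?_⟩
  have h : s / (1 + s) < 1 := by
    rw [div_lt_one (by linarith)]
    linarith
  have h0 : 0 ≤ s / (1 + s) := by positivity
  nlinarith

theorem hasDerivAt_sq_div_one_add {s : ℝ} (hs : 0 ≤ s) :
    HasDerivAt (fun s : ℝ => (s / (1 + s)) ^ 2) (2 * s / (1 + s) ^ 3) s := by
  have h1 : (1 + s) ≠ 0 := by positivity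
  refine (((hasDerivAt_id' s).div ((hasDerivAt_id' s).const_add 1) h1).pow 2).congr_deriv ?_
  simp only [Pi.div_apply]
  norm_num
  field_simp

/-- The sum `(1 + s) ^ (-2a) * ₂F₁(a, a; 1; (s / (1 + s))²)`. -/
noncomputable def coincSum (a s : ℝ) : ℝ :=
  (1 + s) ^ (-(2 * a)) * powSum (sqCoeff a) ((s / (1 + s)) ^ 2)

/-- The logarithmic derivative of `coincSum a`. -/
noncomputable def coincLogDeriv (a s : ℝ) : ℝ :=
  -(2 * a) / (1 + s) + 2 * s / (1 + s) ^ 3 *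
    (powSum (derivCoeff (sqCoeff a)) ((s / (1 + s)) ^ 2) / powSum (sqCoeff a) ((s / (1 + s)) ^ 2))

theorem powSum_sqCoeff_pos {a s : ℝ} (ha : 0 < a) (hs : 0 ≤ s) :
    0 < powSum (sqCoeff a) ((s / (1 + s)) ^ 2) :=
  powSum_pos (polyGrowth_sqCoeff ha) (by simp [sqCoeff_zero]) (sqCoeff_nonneg a)
    (sq_div_one_add_mem hs).1 (sq_div_one_add_mem hs).2

theorem coincSum_pos {a s : ℝ} (ha : 0 < a) (hs : 0 ≤ s) : 0 < coincSum a s :=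
  mul_pos (Real.rpow_pos_of_pos (by linarith) _) (powSum_sqCoeff_pos ha hs)

theorem PolyGrowth.hasDerivAt_comp {e : ℕ → ℝ} (he : PolyGrowth e) {s : ℝ} (hs : 0 ≤ s) :
    HasDerivAt (fun s : ℝ => powSum e ((s / (1 + s)) ^ 2))
      (powSum (_root_.derivCoeff e) ((s / (1 + s)) ^ 2) * (2 * s / (1 + s) ^ 3)) s := by
  obtain ⟨h0, h1⟩ := sq_div_one_add_mem hs
  exact (he.hasDerivAt (by rwa [abs_of_nonneg h0])).comp s (hasDerivAt_sq_div_one_add hs)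

theorem hasDerivAt_coincSum {a s : ℝ} (ha : 0 < a) (hs : 0 ≤ s) :
    HasDerivAt (coincSum a) (coincLogDeriv a s * coincSum a s) s := by
  have h1 : 0 < 1 + s := by linarith
  have hF := (powSum_sqCoeff_pos ha hs).ne'
  have hp : HasDerivAt (fun s : ℝ => (1 + s) ^ (-(2 * a)))
      (1 * -(2 * a) * (1 + s) ^ (-(2 * a) - 1)) s :=
    ((hasDerivAt_id' s).const_add 1).rpow_const (Or.inl h1.ne')
  refine (hp.mul ((polyGrowth_sqCoeff ha).hasDerivAt_comp hs)).congr_deriv ?_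
  simp only [coincSum, coincLogDeriv]
  rw [Real.rpow_sub_one h1.ne']
  generalize powSum (derivCoeff (sqCoeff a)) ((s / (1 + s)) ^ 2) = G at *
  generalize powSum (sqCoeff a) ((s / (1 + s)) ^ 2) = F at *
  field_simp

/-- The Riccati equation of the logarithmic derivative. -/
theorem hasDerivAt_coincLogDeriv {a s : ℝ} (ha : 0 < a) (hs : 0 < s) :
    HasDerivAt (coincLogDeriv a)
      (-(coincLogDeriv a s ^ 2) - (1 + 4 * (a + 1) * (s * (1 + s))) / (s * (1 + s) * (1 + 2 * s)) *
        coincLogDeriv a s - 2 * a / (s * (1 + s))) s := by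
  have h1 : 1 + s ≠ 0 := by positivity
  have h2 : 1 + 2 * s ≠ 0 := by positivity
  have hs0 := hs.ne'
  have hF := (powSum_sqCoeff_pos ha hs.le).ne'
  obtain ⟨z0, z1⟩ := sq_div_one_add_mem hs.le
  have ode := powSum_sqCoeff_ode ha (by rwa [abs_of_nonneg z0])
  have g0 := polyGrowth_sqCoeff ha
  have dq := (g0.derivCoeff.hasDerivAt_comp hs.le).div (g0.hasDerivAt_comp hs.le) hF
  have d1 := (hasDerivAt_const s (-(2 * a))).div ((hasDerivAt_id' s).const_add 1) h1
  have d2 := ((hasDerivAt_id' s).const_mul 2).div (((hasDerivAt_id' s).const_add 1).pow 3)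
    (pow_ne_zero 3 h1)
  have d := d1.add (d2.mul dq)
  refine d.congr_deriv ?_
  simp only [coincLogDeriv, Pi.div_apply, Pi.pow_apply]
  generalize powSum (derivCoeff (derivCoeff (sqCoeff a))) ((s / (1 + s)) ^ 2) = H at *
  generalize powSum (derivCoeff (sqCoeff a)) ((s / (1 + s)) ^ 2) = G at *
  generalize powSum (sqCoeff a) ((s / (1 + s)) ^ 2) = F at *
  -- The differential equation solved for the second derivative; here `z(1-z) = s²(1+2s)/(1+s)⁴`,
  -- which is nonzero because `s > 0`.
  have hH : H = (a ^ 2 * F - (1 - (2 * a + 1) * (s / (1 + s)) ^ 2) * G) * (1 + s) ^ 4 /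
      (s ^ 2 * (1 + 2 * s)) := by
    field_simp at ode ⊢
    linear_combination ode
  rw [hH]
  field_simp
  push_cast
  ring

/-! ### The larger root as a barrier -/

/-- The root `√((a² + 1) u² + 2u + 1)` of the discriminant. -/
noncomputable def discRoot (a u : ℝ) : ℝ := Real.sqrt ((a ^ 2 + 1) * u ^ 2 + 2 * u + 1)

theorem discRoot_sq (a : ℝ) {u : ℝ} (hu : 0 ≤ u) :
    discRoot a u ^ 2 = (a ^ 2 + 1) * u ^ 2 + 2 * u + 1 := Real.sq_sqrt (by positivity)

theorem one_add_le_discRoot (a u : ℝ) : 1 + u ≤ discRoot a u :=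
  Real.le_sqrt_of_sq_le (by nlinarith [sq_nonneg (a * u)])

/-- The larger root of the quadratic on the right of the Riccati equation. -/
noncomputable def riccatiRoot (a s : ℝ) : ℝ :=
  -(4 * a) * (1 + 2 * s) /
    (discRoot a (4 * s * (1 + s)) + 1 + (a + 1) * (4 * s * (1 + s)))

theorem riccatiRoot_den_pos {a s : ℝ} (ha : 0 < a) (hs : 0 ≤ s) :
    0 < discRoot a (4 * s * (1 + s)) + 1 + (a + 1) * (4 * s * (1 + s)) := by
  have := Real.sqrt_nonneg ((a ^ 2 + 1) * (4 * s * (1 + s)) ^ 2 + 2 * (4 * s * (1 + s)) + 1)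
  rw [discRoot]
  positivity

/-- Put `x = 1+2s`, so `u = x²-1` and `R² = a²u² + (1+u)²`. The denominator is `R + (1+u) + au`;
divided by `x` it is `√(a²(x-1/x)² + x²) + x + a(x-1/x)`, increasing in `x`. -/
theorem riccatiRoot_mono {a s t : ℝ} (ha : 0 < a) (hs : 0 ≤ s) (hst : s ≤ t) :
    riccatiRoot a s ≤ riccatiRoot a t := by
  have ht := hs.trans hst
  have hus : 0 ≤ 4 * s * (1 + s) := by positivity
  have hut : 0 ≤ 4 * t * (1 + t) := by positivity
  have hx : ∀ v : ℝ, 4 * v * (1 + v) = (1 + 2 * v) ^ 2 - 1 := fun v => by ring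
  have h1 : ((1 + 2 * s) ^ 2 - 1) * (1 + 2 * t) ≤ ((1 + 2 * t) ^ 2 - 1) * (1 + 2 * s) := by
    have : 0 ≤ (t - s) * ((1 + 2 * s) * (1 + 2 * t) + 1) :=
      mul_nonneg (by linarith) (by positivity)
    linarith
  have h2 : (1 + 2 * s) ^ 2 * (1 + 2 * t) ≤ (1 + 2 * t) ^ 2 * (1 + 2 * s) := by
    have : 0 ≤ (t - s) * ((1 + 2 * s) * (1 + 2 * t)) :=
      mul_nonneg (by linarith) (by positivity)
    linarith
  have h3 : discRoot a (4 * s * (1 + s)) * (1 + 2 * t) ≤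
      discRoot a (4 * t * (1 + t)) * (1 + 2 * s) := by
    refine le_of_sq_le_sq ?_ (mul_nonneg (Real.sqrt_nonneg _) (by linarith))
    rw [mul_pow, mul_pow, discRoot_sq a hus, discRoot_sq a hut, hx, hx]
    have h0 : 0 ≤ ((1 + 2 * s) ^ 2 - 1) * (1 + 2 * t) := by rw [← hx]; positivity
    have h1' := pow_le_pow_left₀ h0 h1 2
    have h2' := pow_le_pow_left₀ (by positivity) h2 2
    nlinarith [mul_le_mul_of_nonneg_left h1' (sq_nonneg a)]
  have key : (discRoot a (4 * s * (1 + s)) + 1 + (a + 1) * (4 * s * (1 + s))) * (1 + 2 * t) ≤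
      (discRoot a (4 * t * (1 + t)) + 1 + (a + 1) * (4 * t * (1 + t))) * (1 + 2 * s) := by
    rw [hx] at h3 ⊢
    rw [hx t] at h3 ⊢
    nlinarith [mul_le_mul_of_nonneg_left h1 ha.le]
  rw [riccatiRoot, riccatiRoot, div_le_div_iff₀ (riccatiRoot_den_pos ha hs)
    (riccatiRoot_den_pos ha ht)]
  nlinarith [mul_le_mul_of_nonneg_left key ha.le]

theorem riccatiRoot_zero (a : ℝ) : riccatiRoot a 0 = -(2 * a) := by
  norm_num [riccatiRoot, discRoot]
  ring

/-- Above the larger root, the right-hand side of the Riccati equation is negative. -/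
theorem riccati_neg {a s g : ℝ} (ha : 0 < a) (hs : 0 < s) (hg : riccatiRoot a s < g) :
    -(g ^ 2) - (1 + 4 * (a + 1) * (s * (1 + s))) / (s * (1 + s) * (1 + 2 * s)) * g
      - 2 * a / (s * (1 + s)) < 0 := by
  have hu : 0 ≤ 4 * s * (1 + s) := by positivity
  have hR := discRoot_sq a hu
  have hR1 := one_add_le_discRoot a (4 * s * (1 + s))
  have hN := riccatiRoot_den_pos ha hs.le
  set R := discRoot a (4 * s * (1 + s))
  -- The usual quadratic formula, recovered from the rationalised form, which unlike it makes sense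
  -- at `s = 0`.
  have hh : 2 * (s * (1 + s)) * (1 + 2 * s) * riccatiRoot a s =
      R - 1 - (a + 1) * (4 * s * (1 + s)) := by
    rw [riccatiRoot, mul_div_assoc', div_eq_iff hN.ne']
    linear_combination -hR
  set h := riccatiRoot a s
  have h2 : 0 < 1 + 2 * s := by linarith
  have hσ : 0 < s * (1 + s) := by positivity
  have hd : 0 < s * (1 + s) * (1 + 2 * s) := by positivity
  have hlin : R < 2 * (s * (1 + s)) * (1 + 2 * s) * g + 1 + (a + 1) * (4 * s * (1 + s)) := by
    nlinarith [mul_lt_mul_of_pos_left hg hd]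
  -- Completing the square: this says that the quadratic is positive at `g`.
  have hsq : R ^ 2 < (2 * (s * (1 + s)) * (1 + 2 * s) * g + 1 + (a + 1) * (4 * s * (1 + s))) ^ 2 :=
    pow_lt_pow_left₀ hlin (by linarith) two_ne_zero
  rw [hR] at hsq
  have key : 0 < s * (1 + s) * (1 + 2 * s) * g ^ 2 + (1 + 4 * (a + 1) * (s * (1 + s))) * g
      + 2 * a * (1 + 2 * s) := by
    refine (mul_pos_iff_of_pos_left (by positivity : 0 < 4 * (s * (1 + s) * (1 + 2 * s)))).1 ?_
    linarith
  have : -(g ^ 2) - (1 + 4 * (a + 1) * (s * (1 + s))) / (s * (1 + s) * (1 + 2 * s)) * g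
      - 2 * a / (s * (1 + s)) = -(s * (1 + s) * (1 + 2 * s) * g ^ 2
        + (1 + 4 * (a + 1) * (s * (1 + s))) * g + 2 * a * (1 + 2 * s)) /
          (s * (1 + s) * (1 + 2 * s)) := by
    field_simp
    ring
  rw [this]
  exact div_neg_of_neg_of_pos (by linarith) hd

theorem continuousAt_coincLogDeriv_zero {a : ℝ} (ha : 0 < a) :
    ContinuousAt (coincLogDeriv a) 0 := by
  have g0 := polyGrowth_sqCoeff ha
  have hF := (powSum_sqCoeff_pos ha le_rfl).ne'
  have c0 := (g0.hasDerivAt_comp le_rfl).continuousAt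
  have c1 := (g0.derivCoeff.hasDerivAt_comp le_rfl).continuousAt
  unfold coincLogDeriv
  refine ContinuousAt.add (ContinuousAt.div (by fun_prop) (by fun_prop) (by norm_num))
    (ContinuousAt.mul (ContinuousAt.div (by fun_prop) (by fun_prop) (by norm_num)) (c1.div c0 hF))

/-- The logarithmic derivative stays below the larger root of the Riccati equation. -/
theorem coincLogDeriv_le {a s : ℝ} (ha : 0 < a) (hs : 0 < s) :
    coincLogDeriv a s ≤ riccatiRoot a s := by
  by_contra! hlt
  -- Time is reversed, `τ ↦ s - τ`, and the barrier is the constant `-g(s)`. Strictness is needed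
  -- only at contact points, where `g(s-τ) = g(s) > h(s) ≥ h(s-τ)`. Stopping at `ε > 0` avoids the
  -- singularity of the equation at `0`.
  have hback : ∀ ε ∈ Set.Ioo 0 s, coincLogDeriv a s ≤ coincLogDeriv a ε := by
    rintro ε ⟨hε, hεs⟩
    have hd : ∀ τ ∈ Set.Icc 0 (s - ε), HasDerivAt (fun τ => -coincLogDeriv a (s - τ))
        (-(coincLogDeriv a (s - τ) ^ 2) - (1 + 4 * (a + 1) * ((s - τ) * (1 + (s - τ)))) /
          ((s - τ) * (1 + (s - τ)) * (1 + 2 * (s - τ))) * coincLogDeriv a (s - τ)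
          - 2 * a / ((s - τ) * (1 + (s - τ)))) τ := fun τ hτ => by
      have := ((hasDerivAt_coincLogDeriv ha (by linarith [hτ.2] : 0 < s - τ)).comp τ
        ((hasDerivAt_id' τ).const_sub s)).neg
      refine this.congr_deriv (by ring)
    have := image_le_of_deriv_right_lt_deriv_boundary
      (f := fun τ => -coincLogDeriv a (s - τ)) (a := 0) (b := s - ε)
      (B := fun _ => -coincLogDeriv a s) (B' := fun _ => 0)
      (fun τ hτ => (hd τ hτ).continuousAt.continuousWithinAt)
      (fun τ hτ => (hd τ ⟨hτ.1, hτ.2.le⟩).hasDerivWithinAt)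
      (by simp) (fun τ => hasDerivAt_const τ _)
      (fun τ hτ heq => riccati_neg ha (by linarith [hτ.2] : 0 < s - τ) (by
        have h1 := riccatiRoot_mono (t := s) ha (by linarith [hτ.2] : 0 ≤ s - τ) (by linarith [hτ.1])
        have h2 := neg_inj.1 heq
        linarith))
      (⟨by linarith, le_rfl⟩ : s - ε ∈ Set.Icc 0 (s - ε))
    simpa using this
  have hlim : Tendsto (coincLogDeriv a) (nhdsWithin 0 (Set.Ioi 0)) (nhds (coincLogDeriv a 0)) :=
    (continuousAt_coincLogDeriv_zero ha).tendsto.mono_left nhdsWithin_le_nhds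
  have hle : coincLogDeriv a s ≤ coincLogDeriv a 0 :=
    ge_of_tendsto hlim (eventually_of_mem (Ioo_mem_nhdsGT hs) hback)
  have h0 : coincLogDeriv a 0 = riccatiRoot a 0 := by
    rw [riccatiRoot_zero a]
    simp [coincLogDeriv]
  have := riccatiRoot_mono ha le_rfl hs.le
  linarith

/-! ### Integrating the barrier -/

theorem hasDerivAt_discRoot (a : ℝ) {u : ℝ} (hu : 0 ≤ u) :
    HasDerivAt (discRoot a) (((a ^ 2 + 1) * u + 1) / discRoot a u) u := by
  have h0 : (a ^ 2 + 1) * u ^ 2 + 2 * u + 1 ≠ 0 := by positivity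
  have h := (((((hasDerivAt_id' u).pow 2).const_mul (a ^ 2 + 1)).add
    ((hasDerivAt_id' u).const_mul 2)).add_const 1).sqrt h0
  refine h.congr_deriv ?_
  have hR := (by linarith [one_add_le_discRoot a u] : 0 < discRoot a u).ne'
  simp only [discRoot, Pi.pow_apply, Pi.add_apply] at hR ⊢
  field_simp
  push_cast
  ring

/-- The logarithm of the first upper bound, as a function of `u = 4cT`. -/
noncomputable def logBound (a r u : ℝ) : ℝ :=
  Real.log 2 - Real.log (1 + u + discRoot a u) - a * Real.log (discRoot a u + a * u) +
    r * Real.log ((r * discRoot a u + r ^ 2 * u + 1) / (r + 1))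

/-- With `u = 4s(1+s)`, multiplying this derivative by `du/ds = 4(1+2s)` yields exactly `2 *
riccatiRoot a s`. The simplifications rest on `R² = a²u² + (1+u)²`. -/
theorem hasDerivAt_logBound {a r u : ℝ} (ha : 0 < a) (hr : 0 < r) (har : r ^ 2 = a ^ 2 + 1)
    (hu : 0 ≤ u) :
    HasDerivAt (logBound a r) (-(2 * a) / (discRoot a u + 1 + (a + 1) * u)) u := by
  have hR1 := one_add_le_discRoot a u
  have hR := discRoot_sq a hu
  have hd := hasDerivAt_discRoot a hu
  have hR0 : 0 < discRoot a u := by linarith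
  have hu' : 0 < 1 + u := by positivity
  have p1 : 0 < 1 + u + discRoot a u := by positivity
  have p2 : 0 < discRoot a u + a * u := by positivity
  have p3 : 0 < r * discRoot a u + r ^ 2 * u + 1 := by positivity
  have p4 : 0 < discRoot a u + 1 + (a + 1) * u := by positivity
  have d1 := (((hasDerivAt_id' u).const_add 1).add hd).log p1.ne'
  have d2 := ((hd.add ((hasDerivAt_id' u).const_mul a)).log p2.ne').const_mul a
  have d3 := (((((hd.const_mul r).add ((hasDerivAt_id' u).const_mul (r ^ 2))).add_const 1).div_const
    (r + 1)).log (div_pos p3 (by positivity)).ne').const_mul r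
  refine ((((hasDerivAt_const u (Real.log 2)).sub d1).sub d2).add d3).congr_deriv ?_
  simp only [Pi.add_apply]
  generalize discRoot a u = R at *
  have e1 : (1 + ((a ^ 2 + 1) * u + 1) / R) / (1 + u + R) =
      (R + ((a ^ 2 + 1) * u + 1)) / (1 + u + R) / R := by field_simp
  have e2 : a * ((((a ^ 2 + 1) * u + 1) / R + a * 1) / (R + a * u)) =
      a * (R + a) / (1 + u) / R := by
    field_simp
    linear_combination -hR
  have e3 : r * ((r * (((a ^ 2 + 1) * u + 1) / R) + r ^ 2 * 1) / (r + 1) /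
      ((r * R + r ^ 2 * u + 1) / (r + 1))) = (a ^ 2 + 1) / R := by
    rw [← har]
    field_simp
    ring
  have e4 : (R + ((a ^ 2 + 1) * u + 1)) / (1 + u + R) - 2 * a * R / (R + 1 + (a + 1) * u) =
      ((a ^ 2 + 1) * u + 1 - a * R) / (1 + u) := by
    rw [div_sub_div _ _ p1.ne' p4.ne', div_eq_div_iff (mul_pos p1 p4).ne' hu'.ne']
    linear_combination a * R * hR
  rw [e1, e2, e3, sub_eq_iff_eq_add.1 e4]
  field_simp
  ring

theorem logBound_zero (a : ℝ) {r : ℝ} (hr : 0 < r) : logBound a r 0 = 0 := by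
  have : r + 1 ≠ 0 := by positivity
  norm_num [logBound, discRoot, this]

theorem coincSum_zero (a : ℝ) : coincSum a 0 = 1 := by
  simp [coincSum, powSum_zero, sqCoeff_zero]

theorem two_mul_log_coincSum_le {a r s : ℝ} (ha : 0 < a) (hr : 0 < r) (har : r ^ 2 = a ^ 2 + 1)
    (hs : 0 ≤ s) : 2 * Real.log (coincSum a s) ≤ logBound a r (4 * s * (1 + s)) := by
  have hd : ∀ s : ℝ, 0 ≤ s → HasDerivAt
      (fun s => 2 * Real.log (coincSum a s) - logBound a r (4 * s * (1 + s)))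
      (2 * (coincLogDeriv a s - riccatiRoot a s)) s := fun s hs => by
    have hu : HasDerivAt (fun s : ℝ => 4 * s * (1 + s)) (4 * (1 + 2 * s)) s :=
      (((hasDerivAt_id' s).const_mul 4).mul ((hasDerivAt_id' s).const_add 1)).congr_deriv (by ring)
    have h1 := ((hasDerivAt_coincSum ha hs).log (coincSum_pos ha hs).ne').const_mul 2
    have h2 := (hasDerivAt_logBound ha hr har
      (by positivity : 0 ≤ 4 * s * (1 + s))).comp s hu
    refine (h1.sub h2).congr_deriv ?_
    rw [mul_div_cancel_right₀ _ (coincSum_pos ha hs).ne', riccatiRoot]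
    ring
  have hanti : AntitoneOn
      (fun s => 2 * Real.log (coincSum a s) - logBound a r (4 * s * (1 + s))) (Set.Ici 0) := by
    refine antitoneOn_of_deriv_nonpos (convex_Ici 0)
      (fun s hs => (hd s hs).continuousAt.continuousWithinAt)
      (fun s hs => ?_) (fun s hs => ?_)
    · rw [interior_Ici] at hs
      exact (hd s (le_of_lt hs)).differentiableAt.differentiableWithinAt
    · rw [interior_Ici] at hs
      rw [(hd s (le_of_lt hs)).deriv]
      linarith [coincLogDeriv_le ha hs]
  have h := hanti (Set.mem_Ici.2 le_rfl) (Set.mem_Ici.2 hs) hs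
  simp [coincSum_zero, logBound_zero a hr] at h
  linarith

theorem coincSum_sq_le {a r s : ℝ} (ha : 0 < a) (hr : 0 < r) (har : r ^ 2 = a ^ 2 + 1)
    (hs : 0 ≤ s) {u : ℝ} (hu : u = 4 * s * (1 + s)) :
    coincSum a s ^ 2 ≤ 2 / (1 + u + discRoot a u) * (1 / (discRoot a u + a * u)) ^ a *
      ((r * discRoot a u + r ^ 2 * u + 1) / (r + 1)) ^ r := by
  have h := two_mul_log_coincSum_le ha hr har hs
  rw [← hu] at h
  have hu0 : 0 ≤ u := by rw [hu]; positivity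
  have hR1 := one_add_le_discRoot a u
  have hR0 : 0 < discRoot a u := by linarith
  have p1 : 0 < 1 + u + discRoot a u := by positivity
  have p2 : 0 < discRoot a u + a * u := by positivity
  have p3 : 0 < (r * discRoot a u + r ^ 2 * u + 1) / (r + 1) := by positivity
  have h1 := Real.exp_le_exp.2 h
  have hY := coincSum_pos ha hs
  rw [logBound, Real.exp_add, Real.exp_sub, Real.exp_sub, Real.exp_log two_pos, Real.exp_log p1,
    mul_comm 2, Real.exp_mul, Real.exp_log hY, mul_comm a (Real.log _), Real.exp_mul,
    Real.exp_log p2, mul_comm r (Real.log _), Real.exp_mul, Real.exp_log p3, Real.rpow_two] at h1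
  rwa [one_div, Real.inv_rpow p2.le, ← div_eq_mul_inv]

/-! ### The simpler bound -/

theorem bound_le_simple {a r u : ℝ} (ha : 0 < a) (hr : 0 < r) (har : r ^ 2 = a ^ 2 + 1)
    (hu : 0 ≤ u) :
    2 / (1 + u + discRoot a u) * (1 / (discRoot a u + a * u)) ^ a *
        ((r * discRoot a u + r ^ 2 * u + 1) / (r + 1)) ^ r ≤
      1 / (1 + u) * (1 + (a + 1) * u) ^ (-a) * (1 + 2 * r * u) ^ r := by
  have hR1 := one_add_le_discRoot a u
  have hR0 : 0 < discRoot a u := by linarith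
  -- The slope `r + 2` is chosen so that `r(1 + (r+2)u) + r²u + 1 = (r+1)(1 + 2ru)`.
  have hR2 : discRoot a u ≤ 1 + r * u + 2 * u := by
    refine Real.sqrt_le_iff.2 ⟨by positivity, ?_⟩
    rw [← har]
    have : 0 ≤ 2 * u + 4 * u ^ 2 + 2 * r * u + 4 * r * u ^ 2 := by positivity
    linarith
  have i1 : 2 / (1 + u + discRoot a u) ≤ 1 / (1 + u) := by
    rw [div_le_div_iff₀ (by positivity) (by positivity)]
    linarith
  have i2 : (1 / (discRoot a u + a * u)) ^ a ≤ (1 + (a + 1) * u) ^ (-a) := by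
    rw [Real.rpow_neg (by positivity), ← Real.inv_rpow (by positivity), ← one_div]
    refine Real.rpow_le_rpow (by positivity) ?_ ha.le
    exact one_div_le_one_div_of_le (by positivity) (by linarith)
  have i3 : ((r * discRoot a u + r ^ 2 * u + 1) / (r + 1)) ^ r ≤ (1 + 2 * r * u) ^ r := by
    refine Real.rpow_le_rpow (by positivity) ?_ hr.le
    rw [div_le_iff₀ (by positivity)]
    nlinarith [mul_le_mul_of_nonneg_left hR2 hr.le]
  gcongr

/-! ### Return to the original series and growth at infinity -/

theorem hasSum_indexProb_sq {n c t : ℝ} (hc : 0 < c) (hn : 0 < n) (ht : 0 ≤ t) :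
    HasSum (fun k : ℕ => indexProb n c k t ^ 2) (coincSum (n / c) (c * t)) := by
  have hs : 0 ≤ c * t := by positivity
  have ha : 0 < n / c := by positivity
  obtain ⟨z0, z1⟩ := sq_div_one_add_mem hs
  have hp : 0 < 1 + c * t := by linarith
  refine ((((polyGrowth_sqCoeff ha).hasSum (by rwa [abs_of_nonneg z0])).mul_left
    ((1 + c * t) ^ (-(2 * (n / c))))).congr_pointwise fun k => ?_)
  have e1 : (1 + c * t) ^ (-(2 * (n / c))) = ((1 + c * t) ^ (-(n / c))) ^ 2 := by
    rw [← Real.rpow_two, ← Real.rpow_mul hp.le]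
    congr 1
    ring
  rw [indexProb, if_neg hc.ne', sqCoeff, neg_div, Real.rpow_sub hp, Real.rpow_natCast, e1,
    ← pow_mul, mul_comm 2 k, pow_mul, div_pow, neg_mul, neg_pow]
  have : ((-1 : ℝ) ^ k) ^ 2 = 1 := by rw [← pow_mul, mul_comm, pow_mul]; simp
  field_simp
  linear_combination (Ring.choose (-(n / c)) k ^ 2 * ((c * t) ^ k) ^ 2) * this

theorem isBigO_of_sq_le {n c r : ℝ} {f : ℝ → ℝ} (hc : 0 < c) (hn : 0 < n) (hr : 0 < r)
    (h : ∀ t : ℝ, 0 ≤ t → f t ^ 2 ≤ 1 / (1 + 4 * (c * t) * (1 + c * t)) *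
      (1 + (n / c + 1) * (4 * (c * t) * (1 + c * t))) ^ (-(n / c)) *
      (1 + 2 * r * (4 * (c * t) * (1 + c * t))) ^ r) :
    f =O[atTop] fun t : ℝ => t ^ (r - n / c - 1) := by
  have ha : 0 < n / c := by positivity
  set a := n / c
  set K : ℝ := 1 / (4 * c ^ 2) * ((a + 1) * (4 * c ^ 2)) ^ (-a) *
    (1 + 2 * r * (4 * c * (1 + c))) ^ r
  have hK : 0 ≤ K := by positivity
  refine IsBigO.of_bound (Real.sqrt K) ?_
  filter_upwards [eventually_ge_atTop 1] with t ht
  have t0 : 0 < t := by linarith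
  -- For `t ≥ 1`, `u` lies between two constant multiples of `t²`; each factor takes the side suited
  -- to the sign of its exponent.
  have l1 : 4 * c ^ 2 * t ^ 2 ≤ 4 * (c * t) * (1 + c * t) := by nlinarith [mul_pos hc t0]
  have l2 : 4 * (c * t) * (1 + c * t) ≤ 4 * c * (1 + c) * t ^ 2 := by
    nlinarith [mul_nonneg (mul_nonneg hc.le t0.le) (sub_nonneg.2 ht)]
  have i1 : 1 / (1 + 4 * (c * t) * (1 + c * t)) ≤ 1 / (4 * c ^ 2) * (t ^ 2) ^ (-1 : ℝ) := by
    rw [Real.rpow_neg_one, ← one_div, one_div_mul_one_div]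
    exact one_div_le_one_div_of_le (by positivity) (by linarith)
  have i2 : (1 + (a + 1) * (4 * (c * t) * (1 + c * t))) ^ (-a) ≤
      ((a + 1) * (4 * c ^ 2)) ^ (-a) * (t ^ 2) ^ (-a) := by
    rw [← Real.mul_rpow (by positivity) (by positivity)]
    refine Real.rpow_le_rpow_of_nonpos (by positivity) ?_ (by linarith)
    nlinarith [mul_le_mul_of_nonneg_left l1 (by positivity : 0 ≤ a + 1)]
  have i3 : (1 + 2 * r * (4 * (c * t) * (1 + c * t))) ^ r ≤
      (1 + 2 * r * (4 * c * (1 + c))) ^ r * (t ^ 2) ^ r := by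
    rw [← Real.mul_rpow (by positivity) (by positivity)]
    refine Real.rpow_le_rpow (by positivity) ?_ hr.le
    nlinarith [mul_le_mul_of_nonneg_left l2 (by positivity : 0 ≤ 2 * r)]
  have hle : f t ^ 2 ≤ K * (t ^ (r - a - 1)) ^ 2 :=
    calc f t ^ 2 ≤ _ := h t t0.le
      _ ≤ (1 / (4 * c ^ 2) * (t ^ 2) ^ (-1 : ℝ)) *
          (((a + 1) * (4 * c ^ 2)) ^ (-a) * (t ^ 2) ^ (-a)) *
          ((1 + 2 * r * (4 * c * (1 + c))) ^ r * (t ^ 2) ^ r) := by gcongr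
      _ = K * ((t ^ 2) ^ (-1 : ℝ) * (t ^ 2) ^ (-a) * (t ^ 2) ^ r) := by ring
      _ = K * (t ^ (r - a - 1)) ^ 2 := by
          rw [← Real.rpow_add (by positivity), ← Real.rpow_add (by positivity), ← Real.rpow_two,
            ← Real.rpow_two, ← Real.rpow_mul t0.le, ← Real.rpow_mul t0.le]
          congr 2
          ring
  rw [Real.norm_eq_abs, Real.norm_eq_abs, ← Real.sqrt_sq_eq_abs, ← Real.sqrt_sq_eq_abs,
    ← Real.sqrt_mul hK]
  exact Real.sqrt_le_sqrt hle

theorem theorem2p1 (n c : ℝ) (hc : 0 < c) (hn : c < n) :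
    (∀ t T ρ R : ℝ, 0 ≤ t → T = t + c * t ^ 2 →
      ρ = Real.sqrt (n ^ 2 + c ^ 2) →
      R = Real.sqrt (16 * ρ ^ 2 * T ^ 2 + 8 * c * T + 1) →
      Summable (fun k : ℕ => indexProb n c k t ^ 2) ∧
      indexCoincidence n c t ^ 2 ≤
        2 / (1 + 4 * c * T + R) * (1 / (R + 4 * n * T)) ^ (n / c) *
          ((ρ * R + 4 * ρ ^ 2 * T + c) / (ρ + c)) ^ (ρ / c) ∧
      2 / (1 + 4 * c * T + R) * (1 / (R + 4 * n * T)) ^ (n / c) *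
          ((ρ * R + 4 * ρ ^ 2 * T + c) / (ρ + c)) ^ (ρ / c) ≤
        1 / (1 + 4 * c * T) * (1 + 4 * (n + c) * T) ^ (-n / c) *
          (1 + 8 * ρ * T) ^ (ρ / c)) ∧
    (fun t : ℝ => indexCoincidence n c t) =O[atTop]
      (fun t : ℝ => t ^ ((Real.sqrt (n ^ 2 + c ^ 2) - n - c) / c)) := by
  have hn0 : 0 < n := hc.trans hn
  have ha : 0 < n / c := by positivity
  set r : ℝ := Real.sqrt (n ^ 2 + c ^ 2) / c
  have hρ0 : 0 < Real.sqrt (n ^ 2 + c ^ 2) := Real.sqrt_pos.2 (by positivity)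
  have hr : 0 < r := by positivity
  have hrρ : Real.sqrt (n ^ 2 + c ^ 2) = r * c := (div_mul_cancel₀ _ hc.ne').symm
  have har : r ^ 2 = (n / c) ^ 2 + 1 := by
    rw [div_pow, Real.sq_sqrt (by positivity)]
    field_simp
  constructor
  · intro t T ρ R ht hT hρ hR
    have hs : 0 ≤ c * t := by positivity
    have hu : 4 * c * T = 4 * (c * t) * (1 + c * t) := by rw [hT]; ring
    have hu0 : 0 ≤ 4 * c * T := by rw [hu]; positivity
    have hS := hasSum_indexProb_sq hc hn0 ht
    have hRd : R = discRoot (n / c) (4 * c * T) := by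
      rw [hR, discRoot, ← har, hρ, hrρ]
      congr 1
      ring
    have e1 : n / c * (4 * c * T) = 4 * n * T := by field_simp
    have e2 : (r * discRoot (n / c) (4 * c * T) + r ^ 2 * (4 * c * T) + 1) / (r + 1) =
        (ρ * R + 4 * ρ ^ 2 * T + c) / (ρ + c) := by
      rw [← hRd, hρ, hrρ]
      have : r * c + c ≠ 0 := by positivity
      field_simp
    have e3 : ρ / c = r := by rw [hρ]
    have e4 : 1 + (n / c + 1) * (4 * c * T) = 1 + 4 * (n + c) * T := by
      field_simp
    have e5 : 1 + 2 * r * (4 * c * T) = 1 + 8 * ρ * T := by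
      rw [hρ, hrρ]
      ring
    have b1 := coincSum_sq_le ha hr har hs hu
    have b2 := bound_le_simple ha hr har hu0
    rw [e2, e1, ← hRd, ← e3] at b1 b2
    rw [e4, ← neg_div, e3, e5, ← e3] at b2
    refine ⟨hS.summable, ?_, b2⟩
    rwa [indexCoincidence, hS.tsum_eq]
  · have hexp : (Real.sqrt (n ^ 2 + c ^ 2) - n - c) / c = r - n / c - 1 := by
      rw [hrρ]
      field_simp
    rw [hexp]
    refine isBigO_of_sq_le hc hn0 hr fun t ht => ?_
    have hs : 0 ≤ c * t := by positivity
    rw [indexCoincidence, (hasSum_indexProb_sq hc hn0 ht).tsum_eq]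
    exact (coincSum_sq_le ha hr har hs rfl).trans (bound_le_simple ha hr har (by positivity))
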